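/- **Theorem (gradient for restricted quantum Boltzmann machines).** Let $v$ and $h$ be finite-dimensional, nonzero (visible and hidden) quantum systems, let $m,n\in\mathbb N$, let $V_1,\dots,V_m$ be Hermitian operators on $v$ and $H_1,\dots,H_n$ Hermitian operators on $h$. For $\theta=(a,b,w)$ with $a\in\mathbb R^m$, $b\in\mathbb R^n$, $w\in\mathbb R^{m\times n}$ put $$G(\theta)=\sum_{i=1}^m a_iV_i\otimes I+I\otimes\sum_{j=1}^n b_jH_j+\sum_{i=1}^m\sum_{j=1}^n w_{i,j}V_i\otimes H_j,\qquad \sigma_{vh}(\theta)=\frac{e^{-G(\theta)}}{\operatorname{Tr}[e^{-G(\theta)}]},$$ $\sigma_v(\theta)=\operatorname{Tr}_h[\sigma_{vh}(\theta)]$ and $\sigma_h(\theta)=\operatorname{Tr}_v[\sigma_{vh}(\theta)]$. Let $\langle A\rangle_\tau=\operatorname{Tr}[A\tau]$ and, for a state $\rho$ on $v$ (positive semidefinite, trace one), $D(\rho\|\sigma)=\operatorname{Tr}[\rho\ln\rho]-\operatorname{Tr}[\rho\ln\sigma]$, with $0\ln 0=0$. Let $$\gamma(t)=\frac2\pi\ln\left|\coth\left(\frac{\pi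 t}{2}\right)\right|,\qquad \beta(t)=\frac{\pi}{2(\cosh(\pi t)+1)},$$ and define $\Sigma^\theta_{v\to vh}=\Phi^\theta_{vh}\circ\Xi^\theta_{v\to vh}\circ\Upsilon^\theta_v$, where $$\Upsilon^\theta_v(X)=\int_{-\infty}^\infty\beta(t)\,\sigma_v(\theta)^{-it/2}X\sigma_v(\theta)^{it/2}\,dt,\qquad \Phi^\theta_{vh}(Y)=\int_{-\infty}^\infty\gamma(t)\,e^{-iG(\theta)t}Ye^{iG(\theta)t}\,dt,$$ $$\Xi^\theta_{v\to vh}(R)=\frac12\left\{\sigma_{vh}(\theta),\ \sigma_v(\theta)^{-1/2}R\,\sigma_v(\theta)^{-1/2}\otimes I_h\right\},\qquad \{A,B\}=AB+BA.$$ Then these integrals converge absolutely, $\Sigma^\theta_{v\to vh}$ is a linear, Hermiticity-preserving and trace-preserving map, and for every state $\rho$ on $v$ and every $\theta$ the partial derivatives of $\theta\mapsto D(\rho\|\sigma_v(\theta))$ exist and equal, for all $i$ and $j$, $$\frac{\partial}{\partial a_i}D(\rho\|\sigma_v(\theta))=\langle V_i\rangle_{\operatorname{Tr}_h[\Sigma^\theta_{v\to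 vh}(\rho)]}-\langle V_i\rangle_{\sigma_v(\theta)},$$ $$\frac{\partial}{\partial b_j}D(\rho\|\sigma_v(\theta))=\langle H_j\rangle_{\operatorname{Tr}_v[\Sigma^\theta_{v\to vh}(\rho)]}-\langle H_j\rangle_{\sigma_h(\theta)},$$ $$\frac{\partial}{\partial w_{i,j}}D(\rho\|\sigma_v(\theta))=\langle V_i\otimes H_j\rangle_{\Sigma^\theta_{v\to vh}(\rho)}-\langle V_i\otimes H_j\rangle_{\sigma_{vh}(\theta)}.$$ -/

import Mathlib

open scoped Kronecker ComplexOrder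

noncomputable section

namespace QBM

/-! Operators on the finite-dimensional visible (resp. hidden) system are complex matrices indexed
by a finite type `v` (resp. `h`); operators on the joint system are indexed by `v × h`. -/

/-- The logarithm of a Hermitian matrix, by functional calculus (with `ln 0 := 0`, which gives the
usual convention `0 ln 0 = 0` in `Tr[ρ ln ρ]`). -/
def matLog {k : Type*} [Fintype k] [DecidableEq k] (A : Matrix k k ℂ) : Matrix k k ℂ :=
  cfc Real.log A

/-- Complex powers `A ^ z = e ^ (z ln A)` of a positive definite matrix. -/
def matPow {k : Type*} [Fintype k] [DecidableEq k] (A : Matrix k k ℂ) (z : ℂ) : Matrix k k ℂ :=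
  NormedSpace.exp (z • matLog A)

/-- A quantum state: a positive semidefinite operator of unit trace. -/
structure IsState {k : Type*} [Fintype k] (ρ : Matrix k k ℂ) : Prop where
  posSemidef : ρ.PosSemidef
  trace_eq_one : ρ.trace = 1

/-- The expectation `⟨A⟩_ρ = Tr[A ρ]`. -/
def expect {k : Type*} [Fintype k] (A ρ : Matrix k k ℂ) : ℂ :=
  (A * ρ).trace

/-- The Umegaki relative entropy `D(ρ‖σ) = Tr[ρ ln ρ] - Tr[ρ ln σ]` (for positive definite `σ`). -/
def relEntropy {k : Type*} [Fintype k] [DecidableEq k] (ρ σ : Matrix k k ℂ) : ℂ :=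
  (ρ * matLog ρ).trace - (ρ * matLog σ).trace

/-- Partial trace over the hidden system. -/
def trH {v h : Type*} [Fintype h] (X : Matrix (v × h) (v × h) ℂ) : Matrix v v ℂ :=
  Matrix.of fun i j => ∑ k, X (i, k) (j, k)

/-- Partial trace over the visible system. -/
def trV {v h : Type*} [Fintype v] (X : Matrix (v × h) (v × h) ℂ) : Matrix h h ℂ :=
  Matrix.of fun i j => ∑ k, X (k, i) (k, j)

/-- The Hamiltonian of the restricted quantum Boltzmann machine. -/
def rbmHamiltonian {v h : Type*} [DecidableEq v] [DecidableEq h] {m n : ℕ}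
    (V : Fin m → Matrix v v ℂ) (H : Fin n → Matrix h h ℂ)
    (a : Fin m → ℝ) (b : Fin n → ℝ) (w : Fin m → Fin n → ℝ) : Matrix (v × h) (v × h) ℂ :=
  (∑ i, (a i : ℂ) • V i) ⊗ₖ (1 : Matrix h h ℂ)
    + (1 : Matrix v v ℂ) ⊗ₖ (∑ j, (b j : ℂ) • H j)
    + ∑ i, ∑ j, (w i j : ℂ) • (V i ⊗ₖ H j)

/-- The thermal state `e^{-G} / Tr[e^{-G}]`. -/
def thermal {k : Type*} [Fintype k] [DecidableEq k] (G : Matrix k k ℂ) : Matrix k k ℂ :=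
  (NormedSpace.exp (-G)).trace⁻¹ • NormedSpace.exp (-G)

/-- The reduced thermal state on the visible system. -/
def sigmaV {v h : Type*} [Fintype v] [DecidableEq v] [Fintype h] [DecidableEq h]
    (G : Matrix (v × h) (v × h) ℂ) : Matrix v v ℂ :=
  trH (thermal G)

/-- The reduced thermal state on the hidden system. -/
def sigmaH {v h : Type*} [Fintype v] [DecidableEq v] [Fintype h] [DecidableEq h]
    (G : Matrix (v × h) (v × h) ℂ) : Matrix h h ℂ :=
  trV (thermal G)

/-- The high-peak tent density `γ(t) = (2/π) ln |coth(π t / 2)|`. -/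
def tentDensity (t : ℝ) : ℝ :=
  2 / Real.pi * Real.log |Real.cosh (Real.pi * t / 2) / Real.sinh (Real.pi * t / 2)|

/-- The logistic density `β(t) = π / (2 (cosh(π t) + 1))`. -/
def logisticDensity (t : ℝ) : ℝ :=
  Real.pi / (2 * (Real.cosh (Real.pi * t) + 1))

/-- The integrand `γ(t) e^{-iGt} Y e^{iGt}`. -/
def phiIntegrand {k : Type*} [Fintype k] [DecidableEq k] (G Y : Matrix k k ℂ) (t : ℝ) :
    Matrix k k ℂ :=
  (tentDensity t : ℂ) • (NormedSpace.exp ((-(Complex.I * t)) • G) * Y *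
    NormedSpace.exp ((Complex.I * t) • G))

/-- `Φ_G(Y) = ∫ γ(t) e^{-iGt} Y e^{iGt} dt`; the matrix-valued integral is taken entrywise. -/
def phiMap {k : Type*} [Fintype k] [DecidableEq k] (G Y : Matrix k k ℂ) : Matrix k k ℂ :=
  Matrix.of fun p q => ∫ t : ℝ, phiIntegrand G Y t p q

/-- The integrand `β(t) A^{-it/2} X A^{it/2}`. -/
def upsilonIntegrand {k : Type*} [Fintype k] [DecidableEq k] (A X : Matrix k k ℂ) (t : ℝ) :
    Matrix k k ℂ :=
  (logisticDensity t : ℂ) • (matPow A (-(Complex.I * t / 2)) * X * matPow A (Complex.I * t / 2))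

/-- `Υ_A(X) = ∫ β(t) A^{-it/2} X A^{it/2} dt`; the matrix-valued integral is taken entrywise. -/
def upsilonMap {k : Type*} [Fintype k] [DecidableEq k] (A X : Matrix k k ℂ) : Matrix k k ℂ :=
  Matrix.of fun p q => ∫ t : ℝ, upsilonIntegrand A X t p q

/-- `Ξ(R) = ½ {σ_vh, σ_v^{-1/2} R σ_v^{-1/2} ⊗ I_h}`. -/
def xiMap {v h : Type*} [Fintype v] [DecidableEq v] [Fintype h] [DecidableEq h]
    (G : Matrix (v × h) (v × h) ℂ) (R : Matrix v v ℂ) : Matrix (v × h) (v × h) ℂ :=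
  let K : Matrix (v × h) (v × h) ℂ :=
    (matPow (sigmaV G) (-(1 / 2)) * R * matPow (sigmaV G) (-(1 / 2))) ⊗ₖ (1 : Matrix h h ℂ)
  (1 / 2 : ℂ) • (thermal G * K + K * thermal G)

/-- `Σ = Φ ∘ Ξ ∘ Υ`, from operators on the visible system to operators on the joint system. -/
def sigmaMap {v h : Type*} [Fintype v] [DecidableEq v] [Fintype h] [DecidableEq h]
    (G : Matrix (v × h) (v × h) ℂ) (X : Matrix v v ℂ) : Matrix (v × h) (v × h) ℂ :=
  phiMap G (xiMap G (upsilonMap (sigmaV G) X))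

/-- Hermiticity-preserving, trace-preserving linear maps. -/
structure IsHPTP {k l : Type*} [Fintype k] [Fintype l]
    (F : Matrix k k ℂ → Matrix l l ℂ) : Prop where
  isLinear : IsLinearMap ℂ F
  hermitian : ∀ X, X.IsHermitian → (F X).IsHermitian
  trace : ∀ X, (F X).trace = X.trace

end QBM

end

/-! In an eigenbasis of `G`, conjugation by `e^{-iGt}` multiplies entry `(p, q)` by `e^{it(x_q -
x_p)}`. Averaging against `γ` thus multiplies it by the Fourier transform `tanh(ω/2)/(ω/2)` at `ω =
x_q - x_p`. In an eigenbasis of `ln σ_v`, `Υ` likewise has symbol `(ω/2)/sinh(ω/2)`. So both maps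
are Schur multipliers (`phiMap_eq_schur`, `upsilonMap_eq_schur`).

By Daleckii–Krein, the derivatives of exp and ln are also Schur multipliers, by divided differences
(`fderiv_exp_smul_eq_schur`, `hasDerivAt_matLog`). Two hyperbolic identities match the symbols: `D
ln(σ_v)[X] = σ_v^{-1/2} Υ(X) σ_v^{-1/2}` and, in a direction `B`, `d e^{-G} = -½{e^{-G}, Φ(B)}`;
hence `dσ_vh = ⟨B⟩ σ_vh - ½{σ_vh, Φ(B)}`.

Real symmetric symbols are self-adjoint for the trace pairing. With `K = σ_v^{-1/2} Υ(ρ)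
σ_v^{-1/2}`, the derivative of `-Tr[ρ ln σ_v]` is therefore `-Tr[(K ⊗ I) dσ_vh]`. Since `Tr[K σ_v] =
Tr ρ = 1`, the first term of `dσ_vh` gives `-⟨B⟩`; moving `Φ` off `B` in the second gives `Tr[B
Σ(ρ)]` (`hasDerivAt_relEntropy_line`). The three gradients are the cases `B = V_i ⊗ I`, `I ⊗ H_j`,
`V_i ⊗ H_j`. -/

noncomputable section

namespace QBM

/-! ### Schur multipliers in an eigenbasis. -/

section

open Matrix

section Schur

variable {k : Type*} [Fintype k] [DecidableEq k] {A : Matrix k k ℂ}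

/-- The unitary matrix of eigenvectors of a Hermitian matrix. -/
def eigU (hA : A.IsHermitian) : Matrix k k ℂ := hA.eigenvectorUnitary

lemma eigU_star_mul (hA : A.IsHermitian) : (eigU hA)ᴴ * eigU hA = 1 :=
  Unitary.coe_star_mul_self hA.eigenvectorUnitary

lemma eigU_mul_star (hA : A.IsHermitian) : eigU hA * (eigU hA)ᴴ = 1 :=
  Unitary.coe_mul_star_self hA.eigenvectorUnitary

/-- A matrix written in an orthonormal eigenbasis of the Hermitian matrix `A`. -/
def inEig (hA : A.IsHermitian) (Y : Matrix k k ℂ) : Matrix k k ℂ := (eigU hA)ᴴ * Y * eigU hA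

lemma inEig_conj (hA : A.IsHermitian) (Y : Matrix k k ℂ) :
    inEig hA (eigU hA * Y * (eigU hA)ᴴ) = Y := by
  calc _ = ((eigU hA)ᴴ * eigU hA) * Y * ((eigU hA)ᴴ * eigU hA) := by
        simp only [inEig, mul_assoc]
    _ = Y := by rw [eigU_star_mul, one_mul, mul_one]

lemma inEig_injective (hA : A.IsHermitian) : Function.Injective (inEig hA) := by
  have h : Function.LeftInverse (fun Y => eigU hA * Y * (eigU hA)ᴴ) (inEig hA) := fun Y => by
    calc _ = (eigU hA * (eigU hA)ᴴ) * Y * (eigU hA * (eigU hA)ᴴ) := by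
          simp only [inEig, mul_assoc]
      _ = Y := by rw [eigU_mul_star, one_mul, mul_one]
  exact h.injective

lemma inEig_add (hA : A.IsHermitian) (X Y : Matrix k k ℂ) :
    inEig hA (X + Y) = inEig hA X + inEig hA Y := by simp only [inEig, mul_add, add_mul]

lemma inEig_smul (hA : A.IsHermitian) (c : ℂ) (Y : Matrix k k ℂ) :
    inEig hA (c • Y) = c • inEig hA Y := by
  simp only [inEig, mul_smul_comm, smul_mul_assoc]

lemma inEig_mul (hA : A.IsHermitian) (X Y : Matrix k k ℂ) :
    inEig hA (X * Y) = inEig hA X * inEig hA Y := by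
  calc _ = (eigU hA)ᴴ * X * 1 * Y * eigU hA := by simp only [inEig, mul_assoc, one_mul]
    _ = _ := by rw [← eigU_mul_star hA]; simp only [inEig, mul_assoc]

lemma inEig_conjTranspose (hA : A.IsHermitian) (Y : Matrix k k ℂ) :
    inEig hA Yᴴ = (inEig hA Y)ᴴ := by simp [inEig, mul_assoc]

lemma trace_inEig (hA : A.IsHermitian) (Y : Matrix k k ℂ) : (inEig hA Y).trace = Y.trace := by
  rw [inEig, mul_assoc, trace_mul_comm, mul_assoc, eigU_mul_star, mul_one]

/-- The Schur multiplier with symbol `m` in an orthonormal eigenbasis of the Hermitian matrix `A`: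
the `(p, q)` entry in that basis is multiplied by `m (x p) (x q)`, where `x` are the eigenvalues. -/
def schur (hA : A.IsHermitian) (m : ℝ → ℝ → ℂ) (Y : Matrix k k ℂ) : Matrix k k ℂ :=
  eigU hA * Matrix.of (fun p q => m (hA.eigenvalues p) (hA.eigenvalues q) * inEig hA Y p q) *
    (eigU hA)ᴴ

/-- With `inEig_injective`, this reduces identities between Schur multipliers to scalar identities,
entry by entry. -/
lemma inEig_schur (hA : A.IsHermitian) (m : ℝ → ℝ → ℂ) (Y : Matrix k k ℂ) (p q : k) :
    inEig hA (schur hA m Y) p q =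
      m (hA.eigenvalues p) (hA.eigenvalues q) * inEig hA Y p q := by
  rw [schur, inEig_conj, of_apply]

lemma schur_schur (hA : A.IsHermitian) (m m' : ℝ → ℝ → ℂ) (Y : Matrix k k ℂ) :
    schur hA m (schur hA m' Y) = schur hA (fun x y => m x y * m' x y) Y := by
  apply inEig_injective hA
  ext p q
  simp only [inEig_schur, mul_assoc]

lemma schur_add_symbol (hA : A.IsHermitian) (m m' : ℝ → ℝ → ℂ) (Y : Matrix k k ℂ) :
    schur hA (fun x y => m x y + m' x y) Y = schur hA m Y + schur hA m' Y := by
  apply inEig_injective hA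
  ext p q
  simp only [inEig_add, Matrix.add_apply, inEig_schur, add_mul]

lemma schur_smul_symbol (hA : A.IsHermitian) (c : ℂ) (m : ℝ → ℝ → ℂ) (Y : Matrix k k ℂ) :
    schur hA (fun x y => c * m x y) Y = c • schur hA m Y := by
  apply inEig_injective hA
  ext p q
  simp only [inEig_smul, Matrix.smul_apply, inEig_schur, smul_eq_mul, mul_assoc]

lemma schur_one_symbol (hA : A.IsHermitian) (Y : Matrix k k ℂ) :
    schur hA (fun _ _ => 1) Y = Y := by
  apply inEig_injective hA
  ext p q
  simp only [inEig_schur, one_mul]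

lemma schur_add (hA : A.IsHermitian) (m : ℝ → ℝ → ℂ) (X Y : Matrix k k ℂ) :
    schur hA m (X + Y) = schur hA m X + schur hA m Y := by
  apply inEig_injective hA
  ext p q
  simp only [inEig_add, Matrix.add_apply, inEig_schur, mul_add]

lemma schur_smul (hA : A.IsHermitian) (m : ℝ → ℝ → ℂ) (c : ℂ) (Y : Matrix k k ℂ) :
    schur hA m (c • Y) = c • schur hA m Y := by
  apply inEig_injective hA
  ext p q
  simp only [inEig_smul, Matrix.smul_apply, inEig_schur, smul_eq_mul, mul_left_comm]

lemma schur_conjTranspose (hA : A.IsHermitian) {m : ℝ → ℝ → ℂ}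
    (hm : ∀ x y, star (m x y) = m y x) (Y : Matrix k k ℂ) :
    (schur hA m Y)ᴴ = schur hA m Yᴴ := by
  apply inEig_injective hA
  ext p q
  simp only [inEig_conjTranspose, conjTranspose_apply, inEig_schur, star_mul', hm]

/-- The pairing is `∑ X_pq Y_qp`, so a multiplier crosses it with its arguments swapped; symmetric
symbols are self-adjoint. -/
lemma trace_schur_mul (hA : A.IsHermitian) (m : ℝ → ℝ → ℂ) (X Y : Matrix k k ℂ) :
    (schur hA m X * Y).trace = (X * schur hA (fun x y => m y x) Y).trace := by
  rw [← trace_inEig hA, ← trace_inEig hA (X * _), inEig_mul, inEig_mul]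
  simp only [trace, diag_apply, mul_apply, inEig_schur]
  exact Finset.sum_congr rfl fun p _ => Finset.sum_congr rfl fun q _ => by ring

lemma trace_schur (hA : A.IsHermitian) {m : ℝ → ℝ → ℂ} (hm : ∀ x, m x x = 1)
    (Y : Matrix k k ℂ) : (schur hA m Y).trace = Y.trace := by
  rw [← trace_inEig hA, ← trace_inEig hA Y]
  simp only [trace, diag_apply, inEig_schur, hm, one_mul]

lemma inEig_self (hA : A.IsHermitian) :
    inEig hA A = diagonal (fun p => (hA.eigenvalues p : ℂ)) := by
  have : A = eigU hA * diagonal (fun p => (hA.eigenvalues p : ℂ)) * (eigU hA)ᴴ := by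
    conv_lhs => rw [hA.spectral_theorem, Unitary.conjStarAlgAut_apply]
    rfl
  exact (congrArg (inEig hA) this).trans (inEig_conj hA _)

lemma inEig_exp_smul (hA : A.IsHermitian) (z : ℂ) :
    inEig hA (NormedSpace.exp (z • A)) =
      diagonal (fun p => Complex.exp (z * hA.eigenvalues p)) := by
  have h1 := eigU_star_mul hA
  have hinv : (eigU hA)⁻¹ = (eigU hA)ᴴ := Matrix.inv_eq_left_inv h1
  have hu : IsUnit (eigU hA) := ⟨⟨eigU hA, _, eigU_mul_star hA, h1⟩, rfl⟩
  have e : NormedSpace.exp (inEig hA (z • A)) = inEig hA (NormedSpace.exp (z • A)) := by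
    rw [inEig, inEig, ← hinv, Matrix.exp_conj' _ _ hu]
  rw [← e, inEig_smul, inEig_self, ← diagonal_smul, Matrix.exp_diagonal, Pi.exp_def,
    Complex.exp_eq_exp_ℂ]
  rfl

lemma mul_mul_eq_schur (hA : A.IsHermitian) {D E : Matrix k k ℂ} {d e : ℝ → ℂ}
    (hD : inEig hA D = diagonal (fun p => d (hA.eigenvalues p)))
    (hE : inEig hA E = diagonal (fun p => e (hA.eigenvalues p))) (Y : Matrix k k ℂ) :
    D * Y * E = schur hA (fun x y => d x * e y) Y := by
  apply inEig_injective hA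
  rw [inEig_mul, inEig_mul, hD, hE]
  ext p q
  rw [inEig_schur, mul_diagonal, diagonal_mul]
  ring

lemma mul_left_eq_schur (hA : A.IsHermitian) {D : Matrix k k ℂ} {d : ℝ → ℂ}
    (hD : inEig hA D = diagonal (fun p => d (hA.eigenvalues p))) (Y : Matrix k k ℂ) :
    D * Y = schur hA (fun x _ => d x) Y := by
  apply inEig_injective hA
  rw [inEig_mul, hD]
  ext p q
  rw [inEig_schur, diagonal_mul]

lemma mul_right_eq_schur (hA : A.IsHermitian) {D : Matrix k k ℂ} {d : ℝ → ℂ}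
    (hD : inEig hA D = diagonal (fun p => d (hA.eigenvalues p))) (Y : Matrix k k ℂ) :
    Y * D = schur hA (fun _ y => d y) Y := by
  apply inEig_injective hA
  rw [inEig_mul, hD]
  ext p q
  rw [inEig_schur, mul_diagonal, mul_comm]

/-- An averaging integral of Schur multipliers is the Schur multiplier whose symbol is the
integral of the symbols. -/
lemma schur_integral (hA : A.IsHermitian) {m : ℝ → ℝ → ℝ → ℂ} {μ : ℝ → ℝ → ℂ}
    (hm : ∀ x y, MeasureTheory.Integrable (fun t => m t x y))
    (hμ : ∀ x y, ∫ t, m t x y = μ x y) (Y : Matrix k k ℂ) (p q : k) :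
    MeasureTheory.Integrable (fun t => schur hA (m t) Y p q) ∧
      ∫ t, schur hA (m t) Y p q = schur hA μ Y p q := by
  simp only [schur, mul_apply (N := (eigU hA)ᴴ), mul_apply (N := of _), of_apply, Finset.sum_mul]
  have hi : ∀ i j, MeasureTheory.Integrable (fun t =>
      eigU hA p i * (m t (hA.eigenvalues i) (hA.eigenvalues j) * inEig hA Y i j) *
        (eigU hA)ᴴ j q) := fun i j =>
    (((hm _ _).mul_const _).const_mul _).mul_const _
  refine ⟨MeasureTheory.integrable_finsetSum _ fun j _ =>
    MeasureTheory.integrable_finsetSum _ fun i _ => hi i j, ?_⟩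
  rw [MeasureTheory.integral_finsetSum _ fun j _ =>
    MeasureTheory.integrable_finsetSum _ fun i _ => hi i j]
  refine Finset.sum_congr rfl fun j _ => ?_
  rw [MeasureTheory.integral_finsetSum _ fun i _ => hi i j]
  refine Finset.sum_congr rfl fun i _ => ?_
  rw [MeasureTheory.integral_mul_const, MeasureTheory.integral_const_mul,
    MeasureTheory.integral_mul_const, hμ]

end Schur

end

/-! ### Fourier transform of the logistic density. -/

section

open MeasureTheory Set

/-- The Fourier transform of the logistic density, by the substitution `u = sigmoid (π t)` in
Euler's Beta integral. -/
lemma integral_logisticDensity_mul_exp {ω : ℝ} :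
    ∫ t : ℝ, (logisticDensity t : ℂ) * Complex.exp (Complex.I * t * ω) =
      Complex.Gamma (1 + Complex.I * (ω / Real.pi)) *
        Complex.Gamma (1 - Complex.I * (ω / Real.pi)) := by
  set z : ℂ := Complex.I * (ω / Real.pi) with hz
  have hzr : z.re = 0 := by
    rw [hz]; norm_cast; simp
  rw [Complex.Gamma_mul_Gamma_eq_betaIntegral (by simp [hzr]) (by simp [hzr])]
  -- The Gamma arguments add up to 2 and `Γ(2) = 1`, which leaves the Beta integral of `u^z (1 -
  -- u)^(-z)` over `(0, 1)`.
  rw [show (1 + z + (1 - z) : ℂ) = ((1 : ℕ) : ℂ) + 1 by push_cast; ring,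
    Complex.Gamma_nat_eq_factorial, Nat.factorial_one, Nat.cast_one, one_mul, Complex.betaIntegral,
    intervalIntegral.integral_of_le zero_le_one, integral_Ioc_eq_integral_Ioo]
  set f : ℝ → ℝ := fun t => Real.sigmoid (Real.pi * t)
  have himg : f '' univ = Ioo 0 1 := by
    rw [← Real.range_sigmoid, image_univ]
    apply Subset.antisymm
    · rintro _ ⟨t, rfl⟩; exact ⟨_, rfl⟩
    · rintro _ ⟨t, rfl⟩
      exact ⟨t / Real.pi, by simp only [f]; rw [mul_div_cancel₀ _ Real.pi_ne_zero]⟩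
  rw [← himg, integral_image_eq_integral_abs_deriv_smul (s := univ) (f := f)
    (f' := fun t => Real.sigmoid (Real.pi * t) * (1 - Real.sigmoid (Real.pi * t)) * Real.pi)
    MeasurableSet.univ, setIntegral_univ]
  · congr 1
    ext t
    set e := Real.exp (Real.pi * t) with he
    have hepos : 0 < e := Real.exp_pos _
    have hs : Real.sigmoid (Real.pi * t) = e / (1 + e) := by
      rw [Real.sigmoid_def, Real.exp_neg, ← he]; field_simp; ring
    have hs' : 1 - Real.sigmoid (Real.pi * t) = 1 / (1 + e) := by
      rw [hs]; field_simp; ring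
    -- The logistic density is the Jacobian of the substitution.
    have hd : logisticDensity t =
        |Real.sigmoid (Real.pi * t) * (1 - Real.sigmoid (Real.pi * t)) * Real.pi| := by
      rw [hs', hs, abs_of_pos (by positivity), logisticDensity, Real.cosh_eq, Real.exp_neg, ← he]
      field_simp
      ring
    rw [← hd]
    have hexp : (f t : ℂ) ^ z * (1 - f t : ℂ) ^ (-z) = Complex.exp (Complex.I * t * ω) := by
      have h1 : 0 < f t := Real.sigmoid_pos _
      have h2 : 0 < 1 - f t := sub_pos.2 (Real.sigmoid_lt_one _)
      rw [show (1 - f t : ℂ) = ((1 - f t : ℝ) : ℂ) by push_cast; rfl,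
        Complex.cpow_def_of_ne_zero (by exact_mod_cast h1.ne'),
        Complex.cpow_def_of_ne_zero (by exact_mod_cast h2.ne'), ← Complex.exp_add,
        ← Complex.ofReal_log h1.le, ← Complex.ofReal_log h2.le]
      -- The logit inverts the sigmoid, so `u^z (1 - u)^(-z) = e^{πtz}`.
      have hl : Real.log (f t) - Real.log (1 - f t) = Real.pi * t := by
        rw [← Real.log_div h1.ne' h2.ne']
        simp only [f]
        rw [hs', hs, div_div_div_cancel_right₀ (by positivity), div_one, he, Real.log_exp]
      congr 1
      have hl' : (Real.log (f t) : ℂ) - Real.log (1 - f t) = Real.pi * t := by exact_mod_cast hl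
      calc _ = ((Real.log (f t) : ℂ) - Real.log (1 - f t)) * z := by ring
        _ = _ := by
          rw [hl', hz]
          have : (Real.pi : ℂ) ≠ 0 := by exact_mod_cast Real.pi_ne_zero
          field_simp
    rw [← hexp, add_sub_cancel_left, show (1 - z - 1 : ℂ) = -z by ring]
    simp [f]
  · intro t _
    have := (Real.hasDerivAt_sigmoid (Real.pi * t)).comp t ((hasDerivAt_id t).const_mul Real.pi)
    simpa [f, Function.comp_def] using this
  · intro s _ t _ hst
    exact mul_left_cancel₀ Real.pi_ne_zero (Real.sigmoid_injective hst)

lemma integral_logisticDensity : ∫ t : ℝ, logisticDensity t = 1 := by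
  have := integral_logisticDensity_mul_exp (ω := 0)
  simp only [Complex.ofReal_zero, mul_zero, Complex.exp_zero, mul_one, zero_div, add_zero,
    sub_zero, Complex.Gamma_one] at this
  rw [integral_complex_ofReal] at this
  exact_mod_cast this

lemma integrable_logisticDensity : Integrable logisticDensity :=
  -- A non-integrable function has integral 0 by convention, so the value 1 forces integrability.
  integrable_of_integral_eq_one integral_logisticDensity

/-- The function `ω / sinh ω`, extended continuously by `1` at `0`. -/
def divSinh (ω : ℝ) : ℝ := if ω = 0 then 1 else ω / Real.sinh ω

/-- Euler reflection: `Γ(1 + z) Γ(1 - z) = πz / sin(πz)` at `z = iω/π`. -/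
lemma integral_logisticDensity_mul_exp_eq (ω : ℝ) :
    ∫ t : ℝ, (logisticDensity t : ℂ) * Complex.exp (Complex.I * t * ω) = divSinh ω := by
  rw [integral_logisticDensity_mul_exp]
  rcases eq_or_ne ω 0 with rfl | hω
  · simp [divSinh]
  · have hpi : (Real.pi : ℂ) ≠ 0 := by exact_mod_cast Real.pi_ne_zero
    have hω' : (ω : ℂ) ≠ 0 := by exact_mod_cast hω
    have hne : Complex.I * (ω / Real.pi) ≠ 0 :=
      mul_ne_zero Complex.I_ne_zero (div_ne_zero hω' hpi)
    rw [add_comm, Complex.Gamma_add_one _ hne, mul_assoc, Complex.Gamma_mul_Gamma_one_sub,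
      show (Real.pi : ℂ) * (Complex.I * (ω / Real.pi)) = ω * Complex.I by field_simp,
      Complex.sin_mul_I, divSinh, if_neg hω]
    have : Complex.sinh ω ≠ 0 := by
      rw [← Complex.ofReal_sinh]; exact_mod_cast Real.sinh_ne_zero.2 hω
    push_cast
    field_simp

end

/-! ### Fourier transform of the high-peak tent density. -/

section

open MeasureTheory Set

lemma hasSum_of_forall_eq {E : Type*} [AddCommMonoid E] [TopologicalSpace E] {f g : ℕ → E} {a : E}
    (hf : HasSum f a) (h : ∀ n, f n = g n) : HasSum g a := funext h ▸ hf

/-- The Mittag-Leffler expansion of the hyperbolic cotangent. -/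
lemma hasSum_coth {y : ℝ} (hy : y ≠ 0) :
    HasSum (fun n : ℕ => 2 * y / (y ^ 2 + (n + 1) ^ 2))
      (Real.pi * Real.cosh (Real.pi * y) / Real.sinh (Real.pi * y) - 1 / y) := by
  have hyc : (y : ℂ) ≠ 0 := by exact_mod_cast hy
  have hz : (y * Complex.I : ℂ) ∈ Complex.integerComplement := by
    rintro ⟨n, hn⟩
    have := congrArg Complex.im hn
    simp at this
    exact hy this.symm
  have hs := (summable_cotTerm hz).hasSum
  -- The real series is `i` times the cotangent series at the imaginary point `iy`.
  have hterm : ∀ n : ℕ, cotTerm (y * Complex.I) n =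
      -Complex.I * ((2 * y / (y ^ 2 + (n + 1) ^ 2) : ℝ) : ℂ) := by
    intro n
    have h1 : (y * Complex.I - (n + 1) : ℂ) ≠ 0 := fun h => by
      have := congrArg Complex.im h; simp at this; exact hy this
    have h2 : (y * Complex.I + (n + 1) : ℂ) ≠ 0 := fun h => by
      have := congrArg Complex.im h; simp at this; exact hy this
    have h3 : (y ^ 2 + (n + 1) ^ 2 : ℂ) ≠ 0 := by
      have : (0 : ℝ) < y ^ 2 + (n + 1) ^ 2 := by positivity
      exact_mod_cast this.ne'
    rw [cotTerm]
    push_cast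
    field_simp
    linear_combination (2 * y ^ 3 * Complex.I) * Complex.I_sq
  have hsum : ∑' n, cotTerm (y * Complex.I) n =
      -Complex.I * ((Real.pi * Real.cosh (Real.pi * y) / Real.sinh (Real.pi * y) - 1 / y :
        ℝ) : ℂ) := by
    have := cot_series_rep' hz
    rw [show (∑' n, cotTerm (y * Complex.I) n) = _ from this.symm, Complex.cot, ← mul_assoc,
      Complex.cos_mul_I, Complex.sin_mul_I]
    have hsh : Complex.sinh (Real.pi * y) ≠ 0 := by
      have := Real.sinh_ne_zero.2 (mul_ne_zero Real.pi_ne_zero hy)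
      rw [← Complex.ofReal_mul, ← Complex.ofReal_sinh]; exact_mod_cast this
    push_cast
    field_simp
    linear_combination (Real.pi * y * Complex.cosh (Real.pi * y) - Complex.sinh (Real.pi * y)) *
      Complex.I_sq
  rw [hsum] at hs
  refine Complex.hasSum_ofReal.1 ?_
  have hI : ∀ z : ℂ, Complex.I * (-Complex.I * z) = z := fun z => by
    linear_combination (-z) * Complex.I_sq
  have h := hs.mul_left Complex.I
  rw [hI] at h
  exact hasSum_of_forall_eq h fun n => by rw [hterm, hI]

/-- The function `tanh (ω / 2) / (ω / 2)`, extended continuously by `1` at `0`. -/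
def tanhDiv (ω : ℝ) : ℝ := if ω = 0 then 1 else Real.tanh (ω / 2) / (ω / 2)

/-- The identity `coth ω - ½ coth(ω/2) = ½ tanh(ω/2)` corresponds to deleting the even integers from
the expansion of `coth`; the `1/y` terms cancel. -/
lemma hasSum_tanhDiv (ω : ℝ) :
    HasSum (fun k : ℕ => 8 / (((2 * k + 1) * Real.pi) ^ 2 + ω ^ 2)) (tanhDiv ω) := by
  -- Index `n` stands for the integer `n + 1`, so the odd indices removed here are the even
  -- integers.
  have key : ∀ {f : ℕ → ℝ} {S O : ℝ}, HasSum f S → HasSum (fun k => f (2 * k + 1)) O →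
      HasSum (fun k => f (2 * k)) (S - O) := fun {f S O} hS hO => by
    have he := (hS.summable.comp_injective (mul_right_injective₀ (two_ne_zero (α := ℕ)))).hasSum
    have := (HasSum.even_add_odd he hO).unique hS
    rw [← this, add_sub_cancel_right]
    exact he
  have hpi := Real.pi_pos
  rcases eq_or_ne ω 0 with rfl | hω
  -- At `ω = 0` the `coth` expansion is replaced by `ζ(2)`.
  · have h1 : HasSum (fun n : ℕ => 1 / ((n : ℝ) + 1) ^ 2) (Real.pi ^ 2 / 6) := by
      have := (hasSum_nat_add_iff' 1).2 hasSum_zeta_two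
      simpa using this
    have h2 : HasSum (fun k : ℕ => 1 / (((2 * k + 1 : ℕ) : ℝ) + 1) ^ 2)
        (1 / 4 * (Real.pi ^ 2 / 6)) := by
      refine hasSum_of_forall_eq (h1.mul_left (1 / 4)) fun k => ?_
      push_cast
      field_simp
      ring
    have h3 := (key h1 h2).mul_left (8 / Real.pi ^ 2)
    rw [show 8 / Real.pi ^ 2 * (Real.pi ^ 2 / 6 - 1 / 4 * (Real.pi ^ 2 / 6)) = tanhDiv 0 by
      rw [tanhDiv, if_pos rfl]; field_simp; norm_num] at h3
    refine hasSum_of_forall_eq h3 fun k => ?_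
    push_cast
    field_simp
    ring
  · have hy1 : ω / Real.pi ≠ 0 := div_ne_zero hω hpi.ne'
    have hy2 : ω / (2 * Real.pi) ≠ 0 := div_ne_zero hω (by positivity)
    have h1 := hasSum_coth hy1
    have h2 := (hasSum_coth hy2).mul_left (1 / 2)
    have h2' := hasSum_of_forall_eq (g := fun k : ℕ => 2 * (ω / Real.pi) /
        ((ω / Real.pi) ^ 2 + (((2 * k + 1 : ℕ) : ℝ) + 1) ^ 2)) h2 fun k => by
      have a1 : (ω / (2 * Real.pi)) ^ 2 + ((k : ℝ) + 1) ^ 2 ≠ 0 := by positivity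
      have a2 : (ω / Real.pi) ^ 2 + (2 * (k : ℝ) + 1 + 1) ^ 2 ≠ 0 := by positivity
      push_cast
      rw [← mul_div_assoc, div_eq_div_iff a1 a2]
      field_simp
      ring
    have h3 := (key h1 h2').mul_left (4 / (Real.pi * ω))
    have hsum : 4 / (Real.pi * ω) * (Real.pi * Real.cosh (Real.pi * (ω / Real.pi)) /
        Real.sinh (Real.pi * (ω / Real.pi)) - 1 / (ω / Real.pi) -
        1 / 2 * (Real.pi * Real.cosh (Real.pi * (ω / (2 * Real.pi))) /
        Real.sinh (Real.pi * (ω / (2 * Real.pi))) - 1 / (ω / (2 * Real.pi)))) = tanhDiv ω := by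
      rw [tanhDiv, if_neg hω, Real.tanh_eq_sinh_div_cosh,
        show Real.pi * (ω / Real.pi) = 2 * (ω / 2) by field_simp,
        show Real.pi * (ω / (2 * Real.pi)) = ω / 2 by field_simp, Real.sinh_two_mul,
        Real.cosh_two_mul]
      have hs : Real.sinh (ω / 2) ≠ 0 := Real.sinh_ne_zero.2 (div_ne_zero hω two_ne_zero)
      have hc := (Real.cosh_pos (ω / 2)).ne'
      field_simp
      ring
    rw [hsum] at h3
    refine hasSum_of_forall_eq h3 fun k => ?_
    have a1 : (ω / Real.pi) ^ 2 + (2 * (k : ℝ) + 1) ^ 2 ≠ 0 := by positivity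
    have a2 : ((2 * (k : ℝ) + 1) * Real.pi) ^ 2 + ω ^ 2 ≠ 0 := by positivity
    push_cast
    rw [← mul_div_assoc, div_eq_div_iff a1 a2]
    field_simp
    ring

lemma integral_exp_neg_abs {c : ℝ} (hc : 0 < c) (ω : ℝ) :
    Integrable (fun t : ℝ => (Real.exp (-(c * |t|)) : ℂ) * Complex.exp (Complex.I * t * ω)) ∧
    ∫ t : ℝ, (Real.exp (-(c * |t|)) : ℂ) * Complex.exp (Complex.I * t * ω) =
      ((2 * c / (c ^ 2 + ω ^ 2) : ℝ) : ℂ) := by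
  have e1 : EqOn (fun t : ℝ => (Real.exp (-(c * |t|)) : ℂ) * Complex.exp (Complex.I * t * ω))
      (fun t : ℝ => Complex.exp ((-c + Complex.I * ω) * t)) (Ioi 0) := fun t ht => by
    simp only [abs_of_pos (mem_Ioi.1 ht)]
    push_cast
    rw [← Complex.exp_add]
    ring_nf
  have e2 : EqOn (fun t : ℝ => (Real.exp (-(c * |t|)) : ℂ) * Complex.exp (Complex.I * t * ω))
      (fun t : ℝ => Complex.exp ((c + Complex.I * ω) * t)) (Iic 0) := fun t ht => by
    simp only [abs_of_nonpos (mem_Iic.1 ht)]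
    push_cast
    rw [← Complex.exp_add]
    ring_nf
  have r1 : (-c + Complex.I * ω : ℂ).re < 0 := by simpa using hc
  have r2 : 0 < (c + Complex.I * ω : ℂ).re := by simpa using hc
  have i1 := (integrableOn_exp_mul_complex_Ioi r1 0).congr_fun e1.symm measurableSet_Ioi
  have i2 := (integrableOn_exp_mul_complex_Iic r2 0).congr_fun e2.symm measurableSet_Iic
  have hi : Integrable
      (fun t : ℝ => (Real.exp (-(c * |t|)) : ℂ) * Complex.exp (Complex.I * t * ω)) := by
    rw [← integrableOn_univ, ← Iic_union_Ioi (a := (0 : ℝ))]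
    exact i2.union i1
  refine ⟨hi, ?_⟩
  rw [← intervalIntegral.integral_Iic_add_Ioi i2 i1, setIntegral_congr_fun measurableSet_Ioi e1,
    setIntegral_congr_fun measurableSet_Iic e2, integral_exp_mul_complex_Ioi r1,
    integral_exp_mul_complex_Iic r2]
  have h1 : (-c + Complex.I * ω : ℂ) ≠ 0 := fun h => by simp [h] at r1
  have h2 : (c + Complex.I * ω : ℂ) ≠ 0 := fun h => by simp [h] at r2
  have h3 : (c ^ 2 + ω ^ 2 : ℂ) ≠ 0 := by
    have : (0 : ℝ) < c ^ 2 + ω ^ 2 := by positivity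
    exact_mod_cast this.ne'
  push_cast
  rw [mul_zero, mul_zero, Complex.exp_zero]
  field_simp
  linear_combination (-2 * c * ω ^ 2 : ℂ) * Complex.I_sq

/-- For `x = e^{-π|t|}` one has `coth(π|t|/2) = (1 + x)/(1 - x)`, whose logarithm is a series in odd
powers of `x`. Each term is a two-sided exponential, and its transform is one term of
`hasSum_tanhDiv`. -/
lemma hasSum_tentDensity {t : ℝ} (ht : t ≠ 0) :
    HasSum (fun k : ℕ => 4 / (Real.pi * (2 * k + 1)) * Real.exp (-((2 * k + 1) * Real.pi * |t|)))
      (tentDensity t) := by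
  have hpos : 0 < Real.pi * |t| := mul_pos Real.pi_pos (abs_pos.2 ht)
  set x := Real.exp (-(Real.pi * |t|)) with hx
  have hx0 : 0 < x := Real.exp_pos _
  have hx1 : x < 1 := Real.exp_lt_one_iff.2 (by linarith)
  have h := (Real.hasSum_log_sub_log_of_abs_lt_one (x := x)
    (by rw [abs_of_pos hx0]; exact hx1)).mul_left (2 / Real.pi)
  suffices e1 : tentDensity t = 2 / Real.pi * (Real.log (1 + x) - Real.log (1 - x)) by
    rw [e1]
    refine hasSum_of_forall_eq h fun k => ?_
    have : Real.exp (-((2 * k + 1) * Real.pi * |t|)) = x ^ (2 * k + 1) := by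
      rw [hx, ← Real.exp_nat_mul]; push_cast; ring_nf
    rw [this]
    field_simp
    norm_num
  · rw [tentDensity, ← Real.log_div (by linarith) (by linarith), abs_div, Real.abs_sinh,
      abs_of_pos (Real.cosh_pos _), ← Real.cosh_abs]
    have ha : |Real.pi * t / 2| = Real.pi * |t| / 2 := by
      rw [abs_div, abs_mul, abs_of_pos Real.pi_pos, abs_two]
    rw [ha]
    congr 2
    set s := Real.pi * |t| / 2
    have hsq : x = Real.exp (-s) * Real.exp (-s) := by
      rw [hx, ← Real.exp_add]; congr 1; simp only [s]; ring
    have hs : 0 < s := by simp only [s]; linarith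
    rw [Real.cosh_eq, Real.sinh_eq, hsq]
    have he : Real.exp (-s) ≠ 0 := (Real.exp_pos _).ne'
    have hes : Real.exp s = (Real.exp (-s))⁻¹ := by rw [Real.exp_neg, inv_inv]
    have hlt : Real.exp (-s) * Real.exp (-s) < 1 := hsq ▸ hx1
    have h1 : 1 - Real.exp (-s) * Real.exp (-s) ≠ 0 := by linarith
    rw [hes]
    have h2 : 1 - Real.exp (-s) ^ 2 ≠ 0 := by rw [sq]; exact h1
    field_simp

/-- The Fourier transform of the high-peak tent density. -/
lemma integral_tentDensity_mul_exp (ω : ℝ) :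
    ∫ t : ℝ, (tentDensity t : ℂ) * Complex.exp (Complex.I * t * ω) = tanhDiv ω := by
  set F : ℕ → ℝ → ℂ := fun k t => ((4 / (Real.pi * (2 * k + 1)) : ℝ) : ℂ) *
    ((Real.exp (-((2 * k + 1) * Real.pi * |t|)) : ℂ) * Complex.exp (Complex.I * t * ω)) with hF
  have hc : ∀ k : ℕ, 0 < (2 * k + 1) * Real.pi := fun k => by positivity
  have hint : ∀ ω : ℝ, ∀ k : ℕ, (4 / (Real.pi * (2 * k + 1))) *
      (2 * ((2 * k + 1) * Real.pi) / (((2 * k + 1) * Real.pi) ^ 2 + ω ^ 2)) =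
      8 / (((2 * k + 1) * Real.pi) ^ 2 + ω ^ 2) := fun ω k => by
    have : (((2 * k + 1) * Real.pi) ^ 2 + ω ^ 2) ≠ 0 := by positivity
    field_simp
    ring
  have hFi : ∀ k, Integrable (F k) := fun k => (integral_exp_neg_abs (hc k) ω).1.const_mul _
  have hFint : ∀ k, ∫ t, F k t = ((8 / (((2 * k + 1) * Real.pi) ^ 2 + ω ^ 2) : ℝ) : ℂ) := by
    intro k
    rw [integral_const_mul, (integral_exp_neg_abs (hc k) ω).2, ← Complex.ofReal_mul, hint]
  -- The norms do not depend on `ω`, so their integrals are the terms of the series at `ω = 0`; this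
  -- justifies exchanging sum and integral.
  have hnorm : ∀ k, ∫ t, ‖F k t‖ = 8 / (((2 * k + 1) * Real.pi) ^ 2 + 0 ^ 2) := by
    intro k
    have h0 := (integral_exp_neg_abs (hc k) 0).2
    simp only [Complex.ofReal_zero, mul_zero, Complex.exp_zero, mul_one] at h0
    rw [integral_complex_ofReal] at h0
    have h0' := Complex.ofReal_injective h0
    have hn : ∀ t, ‖F k t‖ = 4 / (Real.pi * (2 * k + 1)) *
        Real.exp (-((2 * k + 1) * Real.pi * |t|)) := by
      intro t
      have : ‖Complex.exp (Complex.I * t * ω)‖ = 1 := by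
        rw [mul_assoc, mul_comm, ← Complex.ofReal_mul, Complex.norm_exp_ofReal_mul_I]
      simp only [hF, norm_mul, this, mul_one, Complex.norm_real, Real.norm_eq_abs, Real.abs_exp]
      rw [abs_of_pos (by positivity)]
    simp_rw [hn]
    rw [integral_const_mul, h0', hint]
  have hsum := hasSum_integral_of_summable_integral_norm hFi
    (by simp_rw [hnorm]; exact (hasSum_tanhDiv 0).summable)
  have hae : ∀ᵐ t : ℝ, ∑' k, F k t =
      (tentDensity t : ℂ) * Complex.exp (Complex.I * t * ω) := by
    filter_upwards [compl_mem_ae_iff.2 (measure_singleton (0 : ℝ))] with t ht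
    have h := (Complex.hasSum_ofReal.2 (hasSum_tentDensity ht)).mul_right
      (Complex.exp (Complex.I * t * ω))
    rw [← h.tsum_eq]
    congr 1
    ext k
    simp only [hF]
    push_cast
    ring
  rw [integral_congr_ae hae, funext hFint] at hsum
  exact hsum.unique (Complex.hasSum_ofReal.2 (hasSum_tanhDiv ω))

lemma integrable_tentDensity : Integrable tentDensity := by
  have h := integral_tentDensity_mul_exp 0
  simp only [Complex.ofReal_zero, mul_zero, Complex.exp_zero, mul_one, tanhDiv, if_true] at h
  rw [integral_complex_ofReal] at h
  exact integrable_of_integral_eq_one (by exact_mod_cast h)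

lemma integrable_mul_exp {f : ℝ → ℝ} (hf : Integrable f) (ω : ℝ) :
    Integrable (fun t : ℝ => (f t : ℂ) * Complex.exp (Complex.I * t * ω)) := by
  refine hf.ofReal.mul_bdd (c := 1) (by fun_prop) (Filter.Eventually.of_forall fun t => ?_)
  rw [mul_assoc, mul_comm, ← Complex.ofReal_mul, Complex.norm_exp_ofReal_mul_I]

end

/-! ### The averaging maps as Schur multipliers, and divided differences. -/

section

open Matrix

section Averages

variable {k : Type*} [Fintype k] [DecidableEq k]

/-- Covers both averages: `L = G`, `c = 1` for `Φ`, and `L = ln A`, `c = 1/2` for `Υ`. -/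
lemma schur_average {L : Matrix k k ℂ} (hL : L.IsHermitian) {f μ : ℝ → ℝ} (c : ℝ)
    (hf : MeasureTheory.Integrable f)
    (hμ : ∀ ω : ℝ, ∫ t : ℝ, (f t : ℂ) * Complex.exp (Complex.I * t * ω) = μ ω)
    (Y : Matrix k k ℂ) (p q : k) :
    MeasureTheory.Integrable (fun t : ℝ => ((f t : ℂ) •
      (NormedSpace.exp ((-(Complex.I * t * c)) • L) * Y *
        NormedSpace.exp ((Complex.I * t * c) • L))) p q) ∧
    ∫ t : ℝ, ((f t : ℂ) • (NormedSpace.exp ((-(Complex.I * t * c)) • L) * Y *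
        NormedSpace.exp ((Complex.I * t * c) • L))) p q =
      schur hL (fun x y => (μ (c * (y - x)) : ℂ)) Y p q := by
  have e : ∀ t : ℝ, (f t : ℂ) • (NormedSpace.exp ((-(Complex.I * t * c)) • L) * Y *
      NormedSpace.exp ((Complex.I * t * c) • L)) =
      schur hL (fun x y => (f t : ℂ) *
        Complex.exp (Complex.I * t * ((c * (y - x) : ℝ) : ℂ))) Y := by
    intro t
    rw [mul_mul_eq_schur hL (d := fun x => Complex.exp (-(Complex.I * t * c) * x))
      (e := fun x => Complex.exp (Complex.I * t * c * x)) (inEig_exp_smul hL _)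
      (inEig_exp_smul hL _), ← schur_smul_symbol]
    congr 1
    funext x y
    rw [← Complex.exp_add]
    push_cast
    ring_nf
  simp_rw [e]
  exact schur_integral hL (fun x y => integrable_mul_exp hf _) (fun x y => hμ _) Y p q

lemma phiIntegrand_integrable {G : Matrix k k ℂ} (hG : G.IsHermitian) (Y : Matrix k k ℂ)
    (p q : k) : MeasureTheory.Integrable (fun t : ℝ => phiIntegrand G Y t p q) := by
  simpa [phiIntegrand] using
    (schur_average hG 1 integrable_tentDensity integral_tentDensity_mul_exp Y p q).1

lemma phiMap_eq_schur {G : Matrix k k ℂ} (hG : G.IsHermitian) (Y : Matrix k k ℂ) :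
    phiMap G Y = schur hG (fun x y => (tanhDiv (y - x) : ℂ)) Y := by
  ext p q
  simpa [phiMap, phiIntegrand] using
    (schur_average hG 1 integrable_tentDensity integral_tentDensity_mul_exp Y p q).2

/-- No hypothesis on `A`: the functional calculus takes the value 0 off the Hermitian matrices. -/
lemma matLog_isHermitian (A : Matrix k k ℂ) : (matLog A).IsHermitian :=
  cfc_predicate Real.log A

lemma upsilonIntegrand_integrable (A X : Matrix k k ℂ) (p q : k) :
    MeasureTheory.Integrable (fun t : ℝ => upsilonIntegrand A X t p q) := by
  simpa [upsilonIntegrand, matPow, div_eq_mul_inv] using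
    (schur_average (matLog_isHermitian A) 2⁻¹ integrable_logisticDensity
      integral_logisticDensity_mul_exp_eq X p q).1

lemma upsilonMap_eq_schur (A X : Matrix k k ℂ) :
    upsilonMap A X =
      schur (matLog_isHermitian A) (fun x y => (divSinh (2⁻¹ * (y - x)) : ℂ)) X := by
  ext p q
  simpa [upsilonMap, upsilonIntegrand, matPow, div_eq_mul_inv] using
    (schur_average (matLog_isHermitian A) 2⁻¹ integrable_logisticDensity
      integral_logisticDensity_mul_exp_eq X p q).2

lemma tanhDiv_neg (ω : ℝ) : tanhDiv (-ω) = tanhDiv ω := by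
  simp only [tanhDiv, neg_eq_zero, neg_div, Real.tanh_neg, div_neg, neg_neg]

lemma divSinh_neg (ω : ℝ) : divSinh (-ω) = divSinh ω := by
  simp only [divSinh, neg_eq_zero, Real.sinh_neg, neg_div_neg_eq]

/-- The divided difference of the exponential function. -/
def expDiv (x y : ℝ) : ℝ := if x = y then Real.exp x else (Real.exp x - Real.exp y) / (x - y)

/-- The divided difference of the logarithm at the points `e ^ x` and `e ^ y`. -/
def logDiv (x y : ℝ) : ℝ := Real.exp (-(x / 2)) * Real.exp (-(y / 2)) * divSinh (2⁻¹ * (y - x))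

lemma logDiv_comm (x y : ℝ) : logDiv x y = logDiv y x := by
  rw [logDiv, logDiv, ← divSinh_neg]; ring_nf

/-- Rests on `e^y - e^x = 2 e^{(x+y)/2} sinh((y-x)/2)`. It makes the two multipliers mutually
inverse. -/
lemma expDiv_mul_logDiv (x y : ℝ) : expDiv x y * logDiv x y = 1 := by
  rw [expDiv, logDiv, divSinh]
  have hx : Real.exp x = Real.exp (x / 2) * Real.exp (x / 2) := by
    rw [← Real.exp_add]; ring_nf
  have hy : Real.exp y = Real.exp (y / 2) * Real.exp (y / 2) := by
    rw [← Real.exp_add]; ring_nf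
  rcases eq_or_ne x y with rfl | h
  · simp only [if_true, sub_self, mul_zero]
    rw [hx, Real.exp_neg]
    field_simp
  · have h1 : x - y ≠ 0 := sub_ne_zero.2 h
    have h2 : 2⁻¹ * (y - x) ≠ 0 := by simpa [sub_eq_zero] using h.symm
    rw [if_neg h, if_neg h2]
    have hs := Real.sinh_ne_zero.2 h2
    have e : Real.sinh (2⁻¹ * (y - x)) * (2 * Real.exp (x / 2) * Real.exp (y / 2)) =
        Real.exp y - Real.exp x := by
      rw [Real.sinh_eq, show 2⁻¹ * (y - x) = y / 2 - x / 2 by ring, neg_sub, Real.exp_sub,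
        Real.exp_sub, hx, hy]
      field_simp
    have e' : Real.exp x - Real.exp y ≠ 0 := sub_ne_zero.2 (Real.exp_injective.ne h)
    rw [Real.exp_neg, Real.exp_neg]
    have hxp := (Real.exp_pos (x / 2)).ne'
    have hyp := (Real.exp_pos (y / 2)).ne'
    generalize Real.sinh (2⁻¹ * (y - x)) = s at hs e
    field_simp
    linear_combination (y - x) * e

/-- Difference and sum of `e^{-x}`, `e^{-y}` are `2 e^{-(x+y)/2}` times `sinh` and `cosh` of
`(y-x)/2`, so their ratio is `tanh`. The factor `(e^{-x} + e^{-y})/2` is the symbol of the halved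
anticommutator with `e^{-G}`. -/
lemma expDiv_neg_neg (x y : ℝ) :
    expDiv (-x) (-y) = (Real.exp (-x) + Real.exp (-y)) / 2 * tanhDiv (y - x) := by
  rw [expDiv, tanhDiv]
  rcases eq_or_ne x y with rfl | h
  · simp
  · have h1 : y - x ≠ 0 := sub_ne_zero.2 h.symm
    rw [if_neg (by simpa using h), if_neg h1, Real.tanh_eq_sinh_div_cosh]
    have hc := (Real.cosh_pos ((y - x) / 2)).ne'
    have hx : Real.exp (-x) = Real.exp (-(x / 2)) * Real.exp (-(x / 2)) := by
      rw [← Real.exp_add]; ring_nf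
    have hy : Real.exp (-y) = Real.exp (-(y / 2)) * Real.exp (-(y / 2)) := by
      rw [← Real.exp_add]; ring_nf
    have es : Real.sinh ((y - x) / 2) * (2 * (Real.exp (-(x / 2)) * Real.exp (-(y / 2)))) =
        Real.exp (-x) - Real.exp (-y) := by
      rw [Real.sinh_eq, show (y - x) / 2 = -(x / 2) - -(y / 2) by ring, neg_sub, Real.exp_sub,
        Real.exp_sub, hx, hy]
      have hxp := (Real.exp_pos (-(x / 2))).ne'
      have hyp := (Real.exp_pos (-(y / 2))).ne'
      field_simp
    have ec : Real.cosh ((y - x) / 2) * (2 * (Real.exp (-(x / 2)) * Real.exp (-(y / 2)))) =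
        Real.exp (-x) + Real.exp (-y) := by
      rw [Real.cosh_eq, show (y - x) / 2 = -(x / 2) - -(y / 2) by ring, neg_sub, Real.exp_sub,
        Real.exp_sub, hx, hy]
      have hxp := (Real.exp_pos (-(x / 2))).ne'
      have hyp := (Real.exp_pos (-(y / 2))).ne'
      field_simp
    have h2 : -x - -y ≠ 0 := by rwa [neg_sub_neg]
    rw [← es, ← ec]
    field_simp
    ring

/-- The operator `A ^ (-1/2) Υ_A(X) A ^ (-1/2)` is the Schur multiplier of `X` by the divided
difference of the logarithm. -/
lemma matPow_mul_upsilonMap_mul_matPow (A X : Matrix k k ℂ) :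
    matPow A (-(1 / 2)) * upsilonMap A X * matPow A (-(1 / 2)) =
      schur (matLog_isHermitian A) (fun x y => (logDiv x y : ℂ)) X := by
  rw [upsilonMap_eq_schur, matPow, mul_mul_eq_schur (matLog_isHermitian A)
    (d := fun x => Complex.exp (-(1 / 2) * x)) (e := fun x => Complex.exp (-(1 / 2) * x))
    (inEig_exp_smul _ _) (inEig_exp_smul _ _), schur_schur]
  congr 1
  funext x y
  simp only [logDiv]
  push_cast
  ring_nf

/-- The Schur multiplier by the divided difference of `exp (-·)` is `½ {e ^ (-G), Φ_G(B)}`. -/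
lemma schur_expDiv_neg {G : Matrix k k ℂ} (hG : G.IsHermitian) (B : Matrix k k ℂ) :
    schur hG (fun x y => (expDiv (-x) (-y) : ℂ)) B = (1 / 2 : ℂ) •
      (NormedSpace.exp (-G) * phiMap G B + phiMap G B * NormedSpace.exp (-G)) := by
  have h : inEig hG (NormedSpace.exp (-G)) =
      diagonal (fun p => Complex.exp (-1 * (hG.eigenvalues p : ℂ))) := by
    rw [← inEig_exp_smul hG, neg_one_smul]
  rw [mul_left_eq_schur hG (d := fun x => Complex.exp (-1 * x)) h,
    mul_right_eq_schur hG (d := fun x => Complex.exp (-1 * x)) h, phiMap_eq_schur hG,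
    schur_schur, schur_schur, ← schur_add_symbol, ← schur_smul_symbol]
  congr 1
  funext x y
  rw [expDiv_neg_neg]
  push_cast
  ring_nf

lemma trace_phiMap_mul {G : Matrix k k ℂ} (hG : G.IsHermitian) (X Y : Matrix k k ℂ) :
    (phiMap G X * Y).trace = (X * phiMap G Y).trace := by
  rw [phiMap_eq_schur hG, phiMap_eq_schur hG, trace_schur_mul]
  congr 4
  funext x y
  rw [← tanhDiv_neg, neg_sub]

lemma trace_phiMap {G : Matrix k k ℂ} (hG : G.IsHermitian) (Y : Matrix k k ℂ) :
    (phiMap G Y).trace = Y.trace := by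
  rw [phiMap_eq_schur hG, trace_schur hG (by simp [tanhDiv])]

/-- `Φ` is self-adjoint and fixes `e^{-G}`, which is diagonal in the eigenbasis, where the symbol
equals 1. -/
lemma trace_exp_neg_mul_phiMap {G : Matrix k k ℂ} (hG : G.IsHermitian) (Y : Matrix k k ℂ) :
    (NormedSpace.exp (-G) * phiMap G Y).trace = (NormedSpace.exp (-G) * Y).trace := by
  have h : inEig hG (NormedSpace.exp (-G)) =
      diagonal (fun p => Complex.exp (-1 * (hG.eigenvalues p : ℂ))) := by
    rw [← inEig_exp_smul hG, neg_one_smul]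
  have e : phiMap G (NormedSpace.exp (-G)) = NormedSpace.exp (-G) := by
    rw [phiMap_eq_schur hG]
    apply inEig_injective hG
    ext p q
    rw [inEig_schur, h]
    rcases eq_or_ne p q with rfl | hpq
    · simp [tanhDiv]
    · rw [diagonal_apply_ne _ hpq, mul_zero]
  rw [← trace_phiMap_mul hG, e]

lemma phiMap_conjTranspose {G : Matrix k k ℂ} (hG : G.IsHermitian) (Y : Matrix k k ℂ) :
    (phiMap G Y)ᴴ = phiMap G Yᴴ := by
  rw [phiMap_eq_schur hG, phiMap_eq_schur hG, schur_conjTranspose]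
  intro x y
  rw [← tanhDiv_neg, neg_sub]
  exact Complex.conj_ofReal _

end Averages

/-! ### Partial traces: duality with `⊗ I` and positivity. -/

section PartialTrace

variable {v h : Type*} [Fintype v] [Fintype h]

lemma trace_kronecker_one_mul [DecidableEq h] (K : Matrix v v ℂ) (X : Matrix (v × h) (v × h) ℂ) :
    ((K ⊗ₖ (1 : Matrix h h ℂ)) * X).trace = (K * trH X).trace := by
  simp only [trace, diag_apply, mul_apply, kroneckerMap_apply, Fintype.sum_prod_type, trH,
    of_apply, one_apply, mul_ite, mul_one, mul_zero, ite_mul, zero_mul, Finset.sum_ite_eq,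
    Finset.mem_univ, if_true, Finset.mul_sum]
  exact Finset.sum_congr rfl fun i _ => Finset.sum_comm

lemma trace_one_kronecker_mul [DecidableEq v] (K : Matrix h h ℂ) (X : Matrix (v × h) (v × h) ℂ) :
    (((1 : Matrix v v ℂ) ⊗ₖ K) * X).trace = (K * trV X).trace := by
  simp only [trace, diag_apply, mul_apply, kroneckerMap_apply, Fintype.sum_prod_type, trV,
    of_apply, one_apply, ite_mul, one_mul, zero_mul, Finset.mul_sum]
  rw [Finset.sum_comm]
  refine Finset.sum_congr rfl fun a _ => ?_
  rw [Finset.sum_comm (s := (Finset.univ : Finset h))]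
  refine Finset.sum_congr rfl fun i _ => ?_
  rw [Finset.sum_comm]
  simp

end PartialTrace

/-- The partial trace is a sum of principal blocks, at least one of them present because `h` is
nonempty. -/
lemma trH_posDef {v h : Type*} [Fintype h] [Nonempty h] {X : Matrix (v × h) (v × h) ℂ} (hX : X.PosDef) :
    (trH X).PosDef := by
  have e : trH X = ∑ k : h, X.submatrix (fun i => (i, k)) (fun i => (i, k)) := by
    ext i j
    simp [trH, Matrix.sum_apply]
  rw [e]
  have hk : ∀ k : h, (X.submatrix (fun i : v => (i, k)) (fun i => (i, k))).PosDef := fun k =>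
    hX.submatrix fun i j hij => (Prod.mk.inj hij).1
  obtain ⟨k₀⟩ := ‹Nonempty h›
  classical
  rw [← Finset.add_sum_erase _ _ (Finset.mem_univ k₀)]
  exact (hk k₀).add_posSemidef (Matrix.posSemidef_sum _ fun k _ => (hk k).posSemidef)

/-! ### Positivity of thermal states. -/

section Thermal

variable {k : Type*} [Fintype k] [DecidableEq k]

/-- `e^A` is the square of the invertible Hermitian matrix `e^{A/2}`. -/
lemma exp_posDef {A : Matrix k k ℂ} (hA : A.IsHermitian) : (NormedSpace.exp A).PosDef := by
  have h2 : A = (1 / 2 : ℂ) • A + (1 / 2 : ℂ) • A := by rw [← add_smul]; norm_num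
  have hh : ((1 / 2 : ℂ) • A).IsHermitian := by
    rw [IsHermitian, conjTranspose_smul, hA.eq]; norm_num
  rw [h2, Matrix.exp_add_of_commute _ _ (Commute.refl _)]
  nth_rw 1 [← hh.exp.eq]
  exact Matrix.PosDef.conjTranspose_mul_self _
    (Matrix.mulVec_injective_of_isUnit (Matrix.isUnit_exp _))

variable [Nonempty k]

lemma trace_exp_pos {A : Matrix k k ℂ} (hA : A.IsHermitian) :
    0 < (NormedSpace.exp A).trace := (exp_posDef hA).trace_pos

lemma thermal_posDef {G : Matrix k k ℂ} (hG : G.IsHermitian) : (thermal G).PosDef :=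
  (exp_posDef hG.neg).smul (inv_pos.2 (trace_exp_pos hG.neg))

end Thermal

open scoped Matrix.Norms.L2Operator MatrixOrder in
lemma exp_matLog {k : Type*} [Fintype k] [DecidableEq k] {A : Matrix k k ℂ} (hA : A.PosDef) :
    NormedSpace.exp (matLog A) = A := CFC.exp_log A hA.isStrictlyPositive

/-- Right multiplication by `A` has symbol `e^y`, and `logDiv x x * e^x = 1` on the diagonal. This
yields both trace preservation of `Σ` and the coefficient 1 of `⟨B⟩` in the gradient. -/
lemma trace_schur_logDiv_mul {k : Type*} [Fintype k] [DecidableEq k] {A : Matrix k k ℂ}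
    (hA : A.PosDef) (X : Matrix k k ℂ) :
    (schur (matLog_isHermitian A) (fun x y => (logDiv x y : ℂ)) X * A).trace = X.trace := by
  have h : inEig (matLog_isHermitian A) A =
      diagonal (fun p => Complex.exp (1 * ((matLog_isHermitian A).eigenvalues p : ℂ))) := by
    rw [← inEig_exp_smul, one_smul, exp_matLog hA]
  rw [mul_right_eq_schur (matLog_isHermitian A) (d := fun x => Complex.exp (1 * x)) h,
    schur_schur, trace_schur]
  intro x
  have := expDiv_mul_logDiv x x
  rw [expDiv, if_pos rfl] at this
  rw [one_mul]
  exact_mod_cast this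

/-! ### Linearity, Hermiticity and trace preservation of `Σ`. -/

section SigmaMap

variable {v h : Type*} [Fintype v] [DecidableEq v] [Fintype h] [DecidableEq h]

/-- The operator `Ξ(Υ(X))`, in terms of the divided difference of the logarithm. -/
lemma xiMap_upsilonMap (G : Matrix (v × h) (v × h) ℂ) (X : Matrix v v ℂ) :
    xiMap G (upsilonMap (sigmaV G) X) = (1 / 2 : ℂ) •
      (thermal G * (schur (matLog_isHermitian (sigmaV G)) (fun x y => (logDiv x y : ℂ)) X ⊗ₖ 1) +
       (schur (matLog_isHermitian (sigmaV G)) (fun x y => (logDiv x y : ℂ)) X ⊗ₖ 1) *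
        thermal G) := by
  simp only [xiMap, matPow_mul_upsilonMap_mul_matPow]

variable [Nonempty v] [Nonempty h]

lemma sigmaV_posDef {G : Matrix (v × h) (v × h) ℂ} (hG : G.IsHermitian) : (sigmaV G).PosDef :=
  trH_posDef (thermal_posDef hG)

lemma sigmaMap_isHPTP {G : Matrix (v × h) (v × h) ℂ} (hG : G.IsHermitian) :
    IsHPTP (sigmaMap G) where
  isLinear :=
    { map_add := fun X Y => by
        simp only [sigmaMap, xiMap_upsilonMap, phiMap_eq_schur hG, schur_add, add_kronecker,
          mul_add, add_mul, smul_add]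
        abel
      map_smul := fun c X => by
        simp only [sigmaMap, xiMap_upsilonMap, phiMap_eq_schur hG, schur_add, schur_smul,
          smul_kronecker, mul_smul_comm, smul_mul_assoc, smul_add, smul_comm c] }
  hermitian := fun X hX => by
    have hK : (schur (matLog_isHermitian (sigmaV G)) (fun x y => (logDiv x y : ℂ)) X)ᴴ =
        schur (matLog_isHermitian (sigmaV G)) (fun x y => (logDiv x y : ℂ)) X := by
      rw [schur_conjTranspose _ (fun x y => ?_), hX.eq]
      rw [logDiv_comm]
      exact Complex.conj_ofReal _
    rw [IsHermitian, sigmaMap, phiMap_conjTranspose hG, xiMap_upsilonMap, conjTranspose_smul,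
      conjTranspose_add, conjTranspose_mul, conjTranspose_mul, conjTranspose_kronecker,
      (thermal_posDef hG).isHermitian.eq, hK, conjTranspose_one, add_comm]
    norm_num
  trace := fun X => by
    rw [sigmaMap, trace_phiMap hG, xiMap_upsilonMap, trace_smul, trace_add,
      trace_mul_comm (thermal G), trace_kronecker_one_mul, ← sigmaV,
      trace_schur_logDiv_mul (sigmaV_posDef hG), smul_eq_mul]
    ring

end SigmaMap

end

/-! ### Daleckii–Krein formulas for exp and ln. -/

section

open Matrix

section Derivatives

open scoped Matrix.Norms.L2Operator

variable {k : Type*} [Fintype k] [DecidableEq k]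

lemma hasStrictFDerivAt_exp (A : Matrix k k ℂ) :
    HasStrictFDerivAt (NormedSpace.exp : Matrix k k ℂ → Matrix k k ℂ)
      (fderiv ℝ NormedSpace.exp A) A :=
  (NormedSpace.exp_analytic (𝕂 := ℝ) A).hasStrictFDerivAt

lemma hasDerivAt_exp_comp {γ : ℝ → Matrix k k ℂ} {γ' : Matrix k k ℂ} {t : ℝ}
    (hγ : HasDerivAt γ γ' t) :
    HasDerivAt (fun s => NormedSpace.exp (γ s)) (fderiv ℝ NormedSpace.exp (γ t) γ') t :=
  (hasStrictFDerivAt_exp (γ t)).hasFDerivAt.comp_hasDerivAt t hγ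

lemma fderiv_exp_of_commute {A B : Matrix k k ℂ} (h : Commute A B) :
    fderiv ℝ NormedSpace.exp A B = NormedSpace.exp A * B := by
  have h1 : HasDerivAt (fun s : ℝ => A + s • B) B 0 := by
    simpa using ((hasDerivAt_id (0 : ℝ)).smul_const B).const_add A
  have h2 := hasDerivAt_exp_comp h1
  have h3 : HasDerivAt (fun s : ℝ => NormedSpace.exp A * NormedSpace.exp (s • B))
      (NormedSpace.exp A * B) 0 := by
    have := (hasDerivAt_exp_smul_const (𝕂 := ℝ) B (0 : ℝ)).const_mul (NormedSpace.exp A)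
    simpa using this
  have e : (fun s : ℝ => NormedSpace.exp (A + s • B)) =
      fun s : ℝ => NormedSpace.exp A * NormedSpace.exp (s • B) := by
    funext s
    exact Matrix.exp_add_of_commute _ _ (h.smul_right s)
  rw [e] at h2
  simpa using h2.unique h3

lemma hasDerivAt_conj_exp (A C : Matrix k k ℂ) :
    HasDerivAt (fun s : ℝ => NormedSpace.exp (s • (-C)) * A * NormedSpace.exp (s • C))
      (A * C - C * A) 0 := by
  have h1 := hasDerivAt_exp_smul_const (𝕂 := ℝ) (-C) (0 : ℝ)
  have h2 := hasDerivAt_exp_smul_const (𝕂 := ℝ) C (0 : ℝ)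
  have := (h1.mul_const A).mul h2
  simp only [zero_smul, NormedSpace.exp_zero, one_mul, mul_one, neg_mul] at this
  convert! this using 1
  abel

/-- Differentiate `exp(e^{-sC} A e^{sC}) = e^{-sC} e^A e^{sC}` at `s = 0`. -/
lemma fderiv_exp_commutator (A C : Matrix k k ℂ) :
    fderiv ℝ NormedSpace.exp A (A * C - C * A) =
      NormedSpace.exp A * C - C * NormedSpace.exp A := by
  have h2 := hasDerivAt_exp_comp (hasDerivAt_conj_exp A C)
  have e : (fun s : ℝ =>
      NormedSpace.exp (NormedSpace.exp (s • (-C)) * A * NormedSpace.exp (s • C))) =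
      fun s : ℝ => NormedSpace.exp (s • (-C)) * NormedSpace.exp A * NormedSpace.exp (s • C) := by
    funext s
    rw [smul_neg, Matrix.exp_neg, Matrix.exp_conj' _ _ (Matrix.isUnit_exp _)]
  rw [e] at h2
  simpa using h2.unique (hasDerivAt_conj_exp (NormedSpace.exp A) C)

/-- The Daleckii–Krein formula for the derivative of the matrix exponential. -/
lemma fderiv_exp_smul_eq_schur {A : Matrix k k ℂ} (hA : A.IsHermitian) (c : ℝ)
    (B : Matrix k k ℂ) :
    fderiv ℝ NormedSpace.exp ((c : ℂ) • A) B =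
      schur hA (fun x y => (expDiv (c * x) (c * y) : ℂ)) B := by
  set A' := (c : ℂ) • A
  have hd : inEig hA A' = diagonal (fun p => (c * hA.eigenvalues p : ℂ)) := by
    rw [inEig_smul, inEig_self, ← diagonal_smul]; rfl
  have hdl := mul_left_eq_schur hA (d := fun x => (c * x : ℂ)) hd
  have hdr := mul_right_eq_schur hA (d := fun x => (c * x : ℂ)) hd
  have hel := mul_left_eq_schur hA (d := fun x => Complex.exp (c * x : ℂ)) (inEig_exp_smul hA c)
  have her := mul_right_eq_schur hA (d := fun x => Complex.exp (c * x : ℂ)) (inEig_exp_smul hA c)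
  -- Split `B` into a part commuting with `A'` and a commutator `[A', C]`, on which the derivative
  -- is known. Where `c * x = c * y`, the inverse in `C` is 0 by convention.
  set B₀ := schur hA (fun x y => if c * x = c * y then 1 else 0) B with hB₀
  set C := schur hA (fun x y => ((c * x - c * y : ℂ))⁻¹) B with hC
  have hB : B = B₀ + (A' * C - C * A') := by
    apply inEig_injective hA
    ext p q
    rw [hdl, hdr, sub_eq_add_neg, ← neg_one_smul ℂ,
      inEig_add, inEig_add, inEig_smul]
    simp only [Matrix.add_apply, Matrix.smul_apply, inEig_schur, hB₀, hC, smul_eq_mul]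
    split_ifs with h
    · have : (c * hA.eigenvalues p : ℂ) = c * hA.eigenvalues q := by exact_mod_cast h
      rw [this]; ring
    · have : (c * hA.eigenvalues p - c * hA.eigenvalues q : ℂ) ≠ 0 :=
        sub_ne_zero.2 (by exact_mod_cast h)
      linear_combination (-inEig hA B p q) * mul_inv_cancel₀ this
  have hcomm : Commute A' B₀ := by
    apply inEig_injective hA
    ext p q
    rw [hdl, hdr]
    simp only [hB₀, inEig_schur]
    split_ifs with h
    · have : (c * hA.eigenvalues p : ℂ) = c * hA.eigenvalues q := by exact_mod_cast h
      simp only [this]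
    · simp
  conv_lhs => rw [hB]
  rw [map_add, fderiv_exp_of_commute hcomm, fderiv_exp_commutator]
  apply inEig_injective hA
  ext p q
  rw [hel, hel, her, sub_eq_add_neg,
    ← neg_one_smul ℂ, inEig_add, inEig_add, inEig_smul]
  simp only [Matrix.add_apply, Matrix.smul_apply, inEig_schur, hB₀, hC, smul_eq_mul, expDiv]
  split_ifs with h
  · have : (c * hA.eigenvalues p : ℂ) = c * hA.eigenvalues q := by exact_mod_cast h
    push_cast
    rw [this]; ring
  · have : (c * hA.eigenvalues p - c * hA.eigenvalues q : ℂ) ≠ 0 :=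
      sub_ne_zero.2 (by exact_mod_cast h)
    push_cast
    field_simp
    ring

/-- The derivative of the matrix exponential at a Hermitian matrix, as an equivalence. -/
def expDerivEquiv {L : Matrix k k ℂ} (hL : L.IsHermitian) :
    Matrix k k ℂ ≃L[ℝ] Matrix k k ℂ :=
  LinearEquiv.toContinuousLinearEquiv
    { toFun := schur hL (fun x y => (expDiv x y : ℂ))
      map_add' := schur_add hL _
      map_smul' := fun c X => by
        simpa using schur_smul hL (fun x y => (expDiv x y : ℂ)) (c : ℂ) X
      invFun := schur hL (fun x y => (logDiv x y : ℂ))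
      left_inv := fun X => by
        rw [schur_schur]
        refine Eq.trans ?_ (schur_one_symbol hL X)
        congr 1
        funext x y
        rw [mul_comm]
        exact_mod_cast expDiv_mul_logDiv x y
      right_inv := fun X => by
        rw [schur_schur]
        refine Eq.trans ?_ (schur_one_symbol hL X)
        congr 1
        funext x y
        exact_mod_cast expDiv_mul_logDiv x y }

/-- The Daleckii–Krein formula for the logarithm along a curve of positive definite matrices. -/
lemma hasDerivAt_matLog {σ : ℝ → Matrix k k ℂ} {σ' : Matrix k k ℂ} {t : ℝ}
    (hpos : ∀ s, (σ s).PosDef) (hσ : HasDerivAt σ σ' t) :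
    HasDerivAt (fun s => matLog (σ s))
      (schur (matLog_isHermitian (σ t)) (fun x y => (logDiv x y : ℂ)) σ') t := by
  set L := matLog (σ t) with hLdef
  have hL : L.IsHermitian := matLog_isHermitian (σ t)
  have hE : HasStrictFDerivAt (NormedSpace.exp : Matrix k k ℂ → Matrix k k ℂ)
      (expDerivEquiv hL : Matrix k k ℂ →L[ℝ] Matrix k k ℂ) L := by
    have h := hasStrictFDerivAt_exp L
    convert h using 1
    ext1 X
    have := fderiv_exp_smul_eq_schur hL 1 X
    simp only [Complex.ofReal_one, one_smul, one_mul] at this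
    exact this.symm
  -- Continuity keeps `matLog (σ s)` in the neighbourhood where the local inverse of exp undoes exp,
  -- so the two agree near `t`.
  have hcont : ContinuousAt (fun s => matLog (σ s)) t := by
    have h1 : ContinuousOn (CFC.log : Matrix k k ℂ → Matrix k k ℂ)
      {a | IsSelfAdjoint a ∧ IsUnit a} := CFC.continuousOn_log
    have hmem : ∀ s, σ s ∈ {a : Matrix k k ℂ | IsSelfAdjoint a ∧ IsUnit a} :=
      fun s => ⟨(hpos s).isHermitian, (hpos s).isUnit⟩
    exact (h1 _ (hmem t)).tendsto.comp
      (tendsto_nhdsWithin_iff.2 ⟨hσ.continuousAt, Filter.Eventually.of_forall hmem⟩)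
  have hexp : NormedSpace.exp L = σ t := exp_matLog (hpos t)
  have hinv := hE.to_localInverse.hasFDerivAt
  rw [hexp] at hinv
  have hd := hinv.comp_hasDerivAt t hσ
  refine hd.congr_of_eventuallyEq ?_
  filter_upwards [hcont.eventually hE.eventually_left_inverse] with s hs
  rw [exp_matLog (hpos s)] at hs
  exact hs.symm

end Derivatives

end

/-! ### Derivative of the relative entropy along a line of Hamiltonians. -/

section

open Matrix

section Gradient

open scoped Matrix.Norms.L2Operator

variable {k : Type*} [Fintype k] [DecidableEq k]

lemma hasDerivAt_exp_neg_line {G : Matrix k k ℂ} (hG : G.IsHermitian) (B : Matrix k k ℂ) (t₀ : ℝ) :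
    HasDerivAt (fun t : ℝ => NormedSpace.exp (-(G + (t - t₀) • B)))
      (-((1 / 2 : ℂ) • (NormedSpace.exp (-G) * phiMap G B + phiMap G B * NormedSpace.exp (-G))))
      t₀ := by
  have h1 : HasDerivAt (fun t : ℝ => -(G + (t - t₀) • B)) (-B) t₀ := by
    simpa using ((((hasDerivAt_id t₀).sub_const t₀).smul_const B).const_add G).fun_neg
  have h2 := hasDerivAt_exp_comp h1
  have h3 := fderiv_exp_smul_eq_schur hG (-1) B
  simp only [Complex.ofReal_neg, Complex.ofReal_one, neg_one_smul, neg_one_mul] at h3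
  rw [schur_expDiv_neg hG] at h3
  simpa [h3] using h2

lemma hasDerivAt_linearMap_comp {E F : Type*} [NormedAddCommGroup E] [NormedSpace ℝ E]
    [FiniteDimensional ℝ E] [NormedAddCommGroup F] [NormedSpace ℝ F] (f : E →ₗ[ℝ] F)
    {γ : ℝ → E} {γ' : E} {t : ℝ} (hγ : HasDerivAt γ γ' t) :
    HasDerivAt (fun s => f (γ s)) (f γ') t :=
  (LinearMap.toContinuousLinearMap f).hasFDerivAt.comp_hasDerivAt t hγ

/-- The derivative of the thermal state along an affine family of Hamiltonians. -/
lemma hasDerivAt_thermal_line [Nonempty k] {G : Matrix k k ℂ} (hG : G.IsHermitian)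
    (B : Matrix k k ℂ) (t₀ : ℝ) :
    HasDerivAt (fun t : ℝ => thermal (G + (t - t₀) • B))
      ((thermal G * B).trace • thermal G -
        (1 / 2 : ℂ) • (thermal G * phiMap G B + phiMap G B * thermal G)) t₀ := by
  have h1 := hasDerivAt_exp_neg_line hG B t₀
  have h2 := hasDerivAt_linearMap_comp (Matrix.traceLinearMap k ℝ ℂ) h1
  have hG0 : G + (t₀ - t₀) • B = G := by simp
  have hZ := (trace_exp_pos hG.neg).ne'
  have h3 := h2.fun_inv (by simpa using hZ)
  have h4 := h3.fun_smul h1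
  simp only [Matrix.traceLinearMap_apply, hG0] at h4
  refine h4.congr_deriv ?_
  -- The derivative of the partition function, which produces the term `⟨B⟩ σ_vh`.
  have ht : (-((1 / 2 : ℂ) • (NormedSpace.exp (-G) * phiMap G B +
      phiMap G B * NormedSpace.exp (-G)))).trace = -(NormedSpace.exp (-G) * B).trace := by
    rw [trace_neg, trace_smul, trace_add, trace_mul_comm (phiMap G B), trace_exp_neg_mul_phiMap hG,
      smul_eq_mul]
    ring
  rw [ht]
  simp only [thermal, smul_mul_assoc, mul_smul_comm, trace_smul, smul_smul, smul_add, smul_eq_mul,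
    smul_neg, neg_neg]
  rw [sub_eq_neg_add, neg_add, neg_add, mul_comm (_⁻¹) (1 / 2 : ℂ)]
  congr 2
  field_simp

/-- The partial trace over the hidden system, as a real-linear map. -/
def trHLinear (v h : Type*) [Fintype h] :
    Matrix (v × h) (v × h) ℂ →ₗ[ℝ] Matrix v v ℂ where
  toFun := trH
  map_add' X Y := by ext i j; simp [trH, Finset.sum_add_distrib]
  map_smul' c X := by ext i j; simp [trH, Finset.mul_sum]

/-- Left multiplication followed by the trace, as a real-linear functional. -/
def traceMulLinear (ρ : Matrix k k ℂ) : Matrix k k ℂ →ₗ[ℝ] ℂ where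
  toFun X := (ρ * X).trace
  map_add' X Y := by rw [mul_add, trace_add]
  map_smul' c X := by rw [mul_smul_comm, trace_smul]; rfl

variable {v h : Type*} [Fintype v] [DecidableEq v] [Fintype h] [DecidableEq h]
  [Nonempty v] [Nonempty h]

/-- The derivative of the relative entropy along an affine family of Hamiltonians. -/
theorem hasDerivAt_relEntropy_line {ρ : Matrix v v ℂ} (hρ : IsState ρ)
    {G B : Matrix (v × h) (v × h) ℂ} (hG : G.IsHermitian) (hB : B.IsHermitian) (t₀ : ℝ) :
    HasDerivAt (fun t : ℝ => relEntropy ρ (sigmaV (G + (t - t₀) • B)))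
      (expect B (sigmaMap G ρ) - expect B (thermal G)) t₀ := by
  have hpos : ∀ t : ℝ, (sigmaV (G + (t - t₀) • B)).PosDef := fun t =>
    sigmaV_posDef (hG.add (by rw [IsHermitian, conjTranspose_smul, hB.eq]; simp))
  have h1 : HasDerivAt (fun t : ℝ => sigmaV (G + (t - t₀) • B)) _ t₀ :=
    hasDerivAt_linearMap_comp (trHLinear v h) (hasDerivAt_thermal_line hG B t₀)
  have h2 := hasDerivAt_linearMap_comp (traceMulLinear ρ) (hasDerivAt_matLog hpos h1)
  have h3 := h2.const_sub (ρ * matLog ρ).trace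
  refine h3.congr_deriv ?_
  have hG0 : G + (t₀ - t₀) • B = G := by simp
  rw [hG0]
  set σ := sigmaV G with hσ
  set τ := thermal G with hτ
  set K := schur (matLog_isHermitian σ) (fun x y => (logDiv x y : ℂ)) ρ with hK
  -- Pass to adjoints: the derivative of ln moves onto `ρ`, giving `K`, and the partial trace
  -- becomes `⊗ I`.
  have e1 : ∀ X, traceMulLinear ρ
      (schur (matLog_isHermitian σ) (fun x y => (logDiv x y : ℂ)) (trHLinear v h X)) =
      ((K ⊗ₖ (1 : Matrix h h ℂ)) * X).trace := by
    intro X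
    rw [trace_kronecker_one_mul, hK, trace_schur_mul]
    have hc : (fun x y => (logDiv y x : ℂ)) = fun x y => (logDiv x y : ℂ) := by
      funext x y
      rw [logDiv_comm]
    rw [hc]
    rfl
  rw [e1, mul_sub, trace_sub, mul_smul_comm, trace_smul, trace_kronecker_one_mul K τ, hτ,
    ← sigmaV, hK, trace_schur_logDiv_mul (sigmaV_posDef hG), hρ.trace_eq_one, ← hτ, ← hK,
    smul_eq_mul, mul_one, neg_sub, expect, expect, trace_mul_comm B τ, sigmaMap,
    trace_mul_comm B, trace_phiMap_mul hG, xiMap_upsilonMap]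
  -- What remains is cyclicity of the trace in the two halves of the anticommutator.
  congr 1
  rw [mul_smul_comm, smul_mul_assoc, trace_smul, trace_smul, mul_add, add_mul, trace_add,
    trace_add, ← hσ, ← hτ, ← hK, ← mul_assoc, add_comm]
  congr 2
  rw [← mul_assoc, trace_mul_comm, ← mul_assoc]

end Gradient

/-! ### Coordinate lines in parameter space. -/

section Hamiltonian

variable {v h : Type*} [DecidableEq v] [DecidableEq h] {m n : ℕ}
  (V : Fin m → Matrix v v ℂ) (H : Fin n → Matrix h h ℂ)
  (a : Fin m → ℝ) (b : Fin n → ℝ) (w : Fin m → Fin n → ℝ)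

lemma rbmHamiltonian_isHermitian (hV : ∀ i, (V i).IsHermitian) (hH : ∀ j, (H j).IsHermitian) :
    (rbmHamiltonian V H a b w).IsHermitian := by
  simp only [IsHermitian, rbmHamiltonian, conjTranspose_add, conjTranspose_kronecker,
    conjTranspose_sum, conjTranspose_smul, conjTranspose_one, (hV _).eq, (hH _).eq,
    RCLike.star_def, Complex.conj_ofReal]

lemma sum_update_smul {E ι : Type*} [AddCommGroup E] [Module ℂ E] [Fintype ι] [DecidableEq ι]
    (c : ι → ℝ) (X : ι → E) (i : ι) (t : ℝ) :
    ∑ l, (Function.update c i t l : ℂ) • X l = ∑ l, (c l : ℂ) • X l + ((t - c i : ℝ) : ℂ) • X i := by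
  have : ∀ l, (Function.update c i t l : ℂ) • X l =
      (c l : ℂ) • X l + if l = i then ((t - c i : ℝ) : ℂ) • X i else 0 := by
    intro l
    rcases eq_or_ne l i with rfl | hl
    · rw [Function.update_self, if_pos rfl, ← add_smul]; push_cast; ring_nf
    · rw [Function.update_of_ne hl, if_neg hl, add_zero]
  simp only [this, Finset.sum_add_distrib, Finset.sum_ite_eq', Finset.mem_univ, if_true]

/-- Varying one parameter moves `G` along an affine line that passes through `G` at the current
value, matching the base point `t₀` of the line lemmas. -/
lemma rbmHamiltonian_update_visible (i : Fin m) (t : ℝ) :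
    rbmHamiltonian V H (Function.update a i t) b w =
      rbmHamiltonian V H a b w + (t - a i) • (V i ⊗ₖ (1 : Matrix h h ℂ)) := by
  rw [rbmHamiltonian, rbmHamiltonian, sum_update_smul, add_kronecker, smul_kronecker,
    ← Complex.coe_smul]
  abel

lemma rbmHamiltonian_update_hidden (j : Fin n) (t : ℝ) :
    rbmHamiltonian V H a (Function.update b j t) w =
      rbmHamiltonian V H a b w + (t - b j) • ((1 : Matrix v v ℂ) ⊗ₖ H j) := by
  rw [rbmHamiltonian, rbmHamiltonian, sum_update_smul, kronecker_add, kronecker_smul,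
    ← Complex.coe_smul]
  abel

lemma rbmHamiltonian_update_coupling (i : Fin m) (j : Fin n) (t : ℝ) :
    rbmHamiltonian V H a b (Function.update w i (Function.update (w i) j t)) =
      rbmHamiltonian V H a b w + (t - w i j) • (V i ⊗ₖ H j) := by
  have : ∀ l, ∑ j', ((Function.update w i (Function.update (w i) j t) l j' : ℝ) : ℂ) •
      (V l ⊗ₖ H j') = ∑ j', (w l j' : ℂ) • (V l ⊗ₖ H j') +
        if l = i then (t - w i j) • (V i ⊗ₖ H j) else 0 := by
    intro l
    rcases eq_or_ne l i with rfl | hl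
    · rw [Function.update_self, if_pos rfl, sum_update_smul, Complex.coe_smul]
    · rw [Function.update_of_ne hl, if_neg hl, add_zero]
  rw [rbmHamiltonian, rbmHamiltonian]
  simp only [this, Finset.sum_add_distrib, Finset.sum_ite_eq', Finset.mem_univ, if_true]
  abel

end Hamiltonian

end

end QBM

end

theorem mainTheorem10 {v h : Type*} [Fintype v] [DecidableEq v] [Fintype h] [DecidableEq h]
    [Nonempty v] [Nonempty h] {m n : ℕ}
    (V : Fin m → Matrix v v ℂ) (hV : ∀ i, (V i).IsHermitian)
    (H : Fin n → Matrix h h ℂ) (hH : ∀ j, (H j).IsHermitian)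
    (a : Fin m → ℝ) (b : Fin n → ℝ) (w : Fin m → Fin n → ℝ)
    (ρ : Matrix v v ℂ) (hρ : QBM.IsState ρ)
    (G : Matrix (v × h) (v × h) ℂ) (hG : G = QBM.rbmHamiltonian V H a b w) :
    -- the integrals that define the two averaging maps converge absolutely
    (∀ Y p q, MeasureTheory.Integrable (fun t : ℝ => QBM.phiIntegrand G Y t p q)) ∧
    (∀ X p q, MeasureTheory.Integrable
      (fun t : ℝ => QBM.upsilonIntegrand (QBM.sigmaV G) X t p q)) ∧
    QBM.IsHPTP (QBM.sigmaMap G) ∧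
    (∀ i, HasDerivAt
      (fun t : ℝ => QBM.relEntropy ρ
        (QBM.sigmaV (QBM.rbmHamiltonian V H (Function.update a i t) b w)))
      (QBM.expect (V i) (QBM.trH (QBM.sigmaMap G ρ)) - QBM.expect (V i) (QBM.sigmaV G))
      (a i)) ∧
    (∀ j, HasDerivAt
      (fun t : ℝ => QBM.relEntropy ρ
        (QBM.sigmaV (QBM.rbmHamiltonian V H a (Function.update b j t) w)))
      (QBM.expect (H j) (QBM.trV (QBM.sigmaMap G ρ)) - QBM.expect (H j) (QBM.sigmaH G))
      (b j)) ∧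
    (∀ i j, HasDerivAt
      (fun t : ℝ => QBM.relEntropy ρ
        (QBM.sigmaV (QBM.rbmHamiltonian V H a b
          (Function.update w i (Function.update (w i) j t)))))
      (QBM.expect (V i ⊗ₖ H j) (QBM.sigmaMap G ρ)
        - QBM.expect (V i ⊗ₖ H j) (QBM.thermal G))
      (w i j)) := by
  have hGh : G.IsHermitian := hG ▸ QBM.rbmHamiltonian_isHermitian V H a b w hV hH
  refine ⟨QBM.phiIntegrand_integrable hGh, QBM.upsilonIntegrand_integrable _,
    QBM.sigmaMap_isHPTP hGh, fun i => ?_, fun j => ?_, fun i j => ?_⟩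
  · have := QBM.hasDerivAt_relEntropy_line hρ hGh
      (B := V i ⊗ₖ (1 : Matrix h h ℂ))
      (by rw [Matrix.IsHermitian, Matrix.conjTranspose_kronecker, (hV i).eq,
        Matrix.conjTranspose_one]) (a i)
    -- Duality turns joint expectations of `V_i ⊗ I` into expectations in the reduced operators.
    simp only [QBM.expect, QBM.trace_kronecker_one_mul] at this
    simp only [QBM.rbmHamiltonian_update_visible, ← hG]
    exact this
  · have := QBM.hasDerivAt_relEntropy_line hρ hGh
      (B := (1 : Matrix v v ℂ) ⊗ₖ H j)
      (by rw [Matrix.IsHermitian, Matrix.conjTranspose_kronecker, (hH j).eq,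
        Matrix.conjTranspose_one]) (b j)
    simp only [QBM.expect, QBM.trace_one_kronecker_mul] at this
    simp only [QBM.rbmHamiltonian_update_hidden, ← hG]
    exact this
  · have := QBM.hasDerivAt_relEntropy_line hρ hGh
      (B := V i ⊗ₖ H j)
      (by rw [Matrix.IsHermitian, Matrix.conjTranspose_kronecker, (hV i).eq, (hH j).eq]) (w i j)
    simp only [QBM.rbmHamiltonian_update_coupling, ← hG]
    exact this
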